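/- Work in max algebra on $\mathbb{R}_+=[0,\infty)$: $a\oplus b=\max(a,b)$, $a\otimes b=ab$, with the induced products of matrices and vectors; all powers and products of matrices below are max-algebraic. Let $A\in\mathbb{R}_+^{n\times n}$, let $D(A)$ be the digraph on $\{1,\dots,n\}$ with the edges $(i,j)$, $a_{ij}\neq 0$, and let $\lambda(A)$ be the maximum, over the cycles $(i_1,\dots,i_k,i_1)$ of $D(A)$ with $1\le k\le n$, of $(a_{i_1i_2}\cdots a_{i_ki_1})^{1/k}$ ($\lambda(A)=0$ if there are no cycles). A cycle is critical if its geometric mean equals $\lambda(A)$; the critical digraph $\mathcal{C}(A)$ consists of all nodes and edges on critical cycles. The cyclicity of a strongly connected digraph is the gcd of the lengths of its simple cycles; the cyclicity of a digraph made of several such components is the lcm of their cyclicities. Ultimate expansion. Put $K_1^\circ=\{1,\dots,n\}$. Given $K_\mu^\circ$, let $A_\mu^\circ$ be $A$ with all entries outside $K_\mu^\circ\times K_\mu^\circ$ replaced by $0$ and let $\lambda_\mu=\lambda(A_\mu^\circ)$. Stop if $\lambda_\mu=0$. Otherwise let $\mathcal{C}_\mu^\circ=(N_\mu^\circ,E_\mu^\circ)$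 be the critical digraph of $A_\mu^\circ$, $\gamma_\mu^\circ$ its cyclicity, $M_\mu^\circ$ the set of all nodes in the strongly connected components of $D(A)$ that meet $N_\mu^\circ$, and $K_{\mu+1}^\circ=K_\mu^\circ\setminus M_\mu^\circ$. Let $\Sigma$ be the set of the indices $\mu$ with $\lambda_\mu\neq0$, and let $\gamma^\circ$ be the lcm of the $\gamma_\mu^\circ$, $\mu\in\Sigma$. For $\mu\in\Sigma$ let $B_\mu=\bigoplus_{k\ge0}\big((A_\mu^\circ/\lambda_\mu)^{\gamma_\mu^\circ}\big)^k$, let $C_\mu$ (resp. $R_\mu$) be obtained from $B_\mu$ by replacing all columns (resp. rows) with indices outside $N_\mu^\circ$ by $0$, let $S_\mu$ be obtained from $A_\mu^\circ/\lambda_\mu$ by replacing all entries outside $E_\mu^\circ$ by $0$, and let $U_\mu^{(t)}=C_\mu S_\mu^tR_\mu$. For $y\in\mathbb{R}_+^n$ the sequence $\{A^ty,\ t\ge0\}$ is called ultimately linear periodic if there is $\lambda(y)\in\mathbb{R}_+$ with $A^{t+\gamma^\circ}y=\lambda(y)^{\gamma^\circ}A^ty$ for all sufficiently large $t$. The matrix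 $A$ is called orbit periodic if this holds for every $y\in\mathbb{R}_+^n$. Write $\operatorname{supp}(y)=\{i: y_i\neq0\}$ and let $e_i$ be the $i$-th unit vector. Theorem. Suppose that $\{A^te_i,\ t\ge0\}$ is ultimately linear periodic for every node $i$ that lies on a cycle of $D(A)$. Then $A$ is orbit periodic if and only if for all $\mu,\nu\in\Sigma$ $$\lambda_\mu<\lambda_\nu\ \Longrightarrow\ \bigcup_{i\in N_\mu^\circ}\operatorname{supp}(U_\mu^{(1)}e_i)\subseteq\bigcap_{j\in N_\nu^\circ}\operatorname{supp}(U_\nu^{(1)}e_j).$$ -/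

import Mathlib

open scoped NNReal

namespace MaxAlg

noncomputable section

/-! ### Max algebra over the nonnegative reals: `a ⊕ b = max a b`, `a ⊗ b = a * b` -/

/-- Max-algebraic matrix product, `(A ⊗ B) i j = max_k A i k * B k j` (`⊥ = 0` in `ℝ≥0`). -/
def mul {n : ℕ} (A B : Matrix (Fin n) (Fin n) ℝ≥0) : Matrix (Fin n) (Fin n) ℝ≥0 :=
  fun i j => Finset.univ.sup fun k => A i k * B k j

/-- Max-algebraic product of a matrix and a vector. -/
def mulVec {n : ℕ} (A : Matrix (Fin n) (Fin n) ℝ≥0) (y : Fin n → ℝ≥0) : Fin n → ℝ≥0 :=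
  fun i => Finset.univ.sup fun k => A i k * y k

/-- Max-algebraic power `A ^ t`, with `A ^ 0 = I`. -/
def pow {n : ℕ} (A : Matrix (Fin n) (Fin n) ℝ≥0) : ℕ → Matrix (Fin n) (Fin n) ℝ≥0
  | 0 => 1
  | t + 1 => mul (pow A t) A

/-- Kleene star `I ⊕ A ⊕ A² ⊕ …`, entrywise supremum of all max-algebraic powers. It is only
used for matrices of maximum cycle geometric mean `1`, for which the supremum is finite. -/
def kleeneStar {n : ℕ} (A : Matrix (Fin n) (Fin n) ℝ≥0) : Matrix (Fin n) (Fin n) ℝ≥0 :=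
  fun i j => ⨆ t : ℕ, pow A t i j

/-- The unit vector `e_i`. -/
def unitVec {n : ℕ} (i : Fin n) : Fin n → ℝ≥0 := Pi.single i 1

/-- Support of a vector. -/
def supp {n : ℕ} (y : Fin n → ℝ≥0) : Set (Fin n) := {i | y i ≠ 0}

/-! ### Digraphs, given by their edge relation on the nodes `Fin n` -/

/-- The edge relation of the digraph associated with `A`. -/
def edge {n : ℕ} (A : Matrix (Fin n) (Fin n) ℝ≥0) (i j : Fin n) : Prop := A i j ≠ 0

/-- `c 0, c 1, …, c k = c 0` is a cycle of length `k ≥ 1` (nodes may be repeated). The values of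
`c` beyond `k` are irrelevant. -/
structure IsCycle {n : ℕ} (E : Fin n → Fin n → Prop) (k : ℕ) (c : ℕ → Fin n) : Prop where
  pos : 1 ≤ k
  closed : c k = c 0
  edges : ∀ t < k, E (c t) (c (t + 1))

/-- A simple cycle: `c 0, …, c (k - 1)` are pairwise distinct. -/
def IsSimpleCycle {n : ℕ} (E : Fin n → Fin n → Prop) (k : ℕ) (c : ℕ → Fin n) : Prop :=
  IsCycle E k c ∧ Set.InjOn c (Set.Iio k)

/-- The node `i` belongs to some cycle, i.e. it lies in a nontrivial component. -/
def OnCycle {n : ℕ} (E : Fin n → Fin n → Prop) (i : Fin n) : Prop :=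
  ∃ k c, IsCycle E k c ∧ ∃ t < k, c t = i

/-- `i` and `j` are in the same strongly connected component (paths of length `0` are allowed). -/
def SameComp {n : ℕ} (E : Fin n → Fin n → Prop) (i j : Fin n) : Prop :=
  Relation.ReflTransGen E i j ∧ Relation.ReflTransGen E j i

open scoped Classical in
/-- Cyclicity of the strongly connected component of the node `i`: the gcd of the lengths of all
simple cycles in this component. (A simple cycle has length at most `n`.) -/
def compCyclicity {n : ℕ} (E : Fin n → Fin n → Prop) (i : Fin n) : ℕ :=
  ((Finset.range (n + 1)).filter
    fun k => ∃ c, IsSimpleCycle E k c ∧ SameComp E (c 0) i).gcd id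

open scoped Classical in
/-- Cyclicity of a digraph with several components: the lcm of the cyclicities of its
(nontrivial) components. -/
def cyclicity {n : ℕ} (E : Fin n → Fin n → Prop) : ℕ :=
  (Finset.univ.filter fun i => OnCycle E i).lcm (compCyclicity E)

/-! ### Maximum cycle geometric mean and the critical digraph -/

/-- Weight of the cycle `c` of length `k`. -/
def weight {n : ℕ} (A : Matrix (Fin n) (Fin n) ℝ≥0) (k : ℕ) (c : ℕ → Fin n) : ℝ≥0 :=
  ∏ t ∈ Finset.range k, A (c t) (c (t + 1))

/-- Geometric mean of the cycle `c` of length `k`. -/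
def geoMean {n : ℕ} (A : Matrix (Fin n) (Fin n) ℝ≥0) (k : ℕ) (c : ℕ → Fin n) : ℝ≥0 :=
  weight A k c ^ (1 / (k : ℝ))

/-- Maximum cycle geometric mean: the maximum (of a finite set) of the geometric means of all
cycles of length at most `n` in the digraph of `A`; it is `0` if there are no cycles. -/
def mcgm {n : ℕ} (A : Matrix (Fin n) (Fin n) ℝ≥0) : ℝ≥0 :=
  sSup {x | ∃ k c, k ≤ n ∧ IsCycle (edge A) k c ∧ x = geoMean A k c}

/-- Critical cycles: cycles whose geometric mean is the maximal one. -/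
def IsCritCycle {n : ℕ} (A : Matrix (Fin n) (Fin n) ℝ≥0) (k : ℕ) (c : ℕ → Fin n) : Prop :=
  IsCycle (edge A) k c ∧ geoMean A k c = mcgm A

/-- Critical nodes. -/
def critNodes {n : ℕ} (A : Matrix (Fin n) (Fin n) ℝ≥0) : Set (Fin n) :=
  {i | ∃ k c, IsCritCycle A k c ∧ ∃ t < k, c t = i}

/-- Critical edges, i.e. the edge relation of the critical digraph. -/
def critEdge {n : ℕ} (A : Matrix (Fin n) (Fin n) ℝ≥0) (i j : Fin n) : Prop :=
  ∃ k c, IsCritCycle A k c ∧ ∃ t < k, c t = i ∧ c (t + 1) = j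

/-! ### CSR products -/

/-- `A / λ(A)`. -/
def normalize {n : ℕ} (A : Matrix (Fin n) (Fin n) ℝ≥0) : Matrix (Fin n) (Fin n) ℝ≥0 :=
  fun i j => A i j / mcgm A

/-- The Kleene star `B = ((A / λ(A)) ^ γ)^*`, where `γ` is the cyclicity of the critical
digraph of `A`. -/
def starB {n : ℕ} (A : Matrix (Fin n) (Fin n) ℝ≥0) : Matrix (Fin n) (Fin n) ℝ≥0 :=
  kleeneStar (pow (normalize A) (cyclicity (critEdge A)))

open scoped Classical in
/-- `C`: the columns of `B` with critical indices, the other columns being `0`. -/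
def matC {n : ℕ} (A : Matrix (Fin n) (Fin n) ℝ≥0) : Matrix (Fin n) (Fin n) ℝ≥0 :=
  fun i j => if j ∈ critNodes A then starB A i j else 0

open scoped Classical in
/-- `R`: the rows of `B` with critical indices, the other rows being `0`. -/
def matR {n : ℕ} (A : Matrix (Fin n) (Fin n) ℝ≥0) : Matrix (Fin n) (Fin n) ℝ≥0 :=
  fun i j => if i ∈ critNodes A then starB A i j else 0

open scoped Classical in
/-- `S`: the critical entries of `A / λ(A)`, the other entries being `0`. -/
def matS {n : ℕ} (A : Matrix (Fin n) (Fin n) ℝ≥0) : Matrix (Fin n) (Fin n) ℝ≥0 :=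
  fun i j => if critEdge A i j then normalize A i j else 0

/-- The product `C S^t R` for the whole critical digraph of `A`. -/
def csr {n : ℕ} (A : Matrix (Fin n) (Fin n) ℝ≥0) (t : ℕ) : Matrix (Fin n) (Fin n) ℝ≥0 :=
  mul (mul (matC A) (pow (matS A) t)) (matR A)

/-! ### The ultimate expansion

Terms are numbered from `0`. The construction runs as long as `λ_μ ≠ 0`; from the first `μ` with
`λ_μ = 0` on, nothing changes any more and `λ` remains `0`. -/

open scoped Classical in
/-- The matrix `A` with all entries outside `K × K` replaced by `0`. -/
def restrict {n : ℕ} (A : Matrix (Fin n) (Fin n) ℝ≥0) (K : Set (Fin n)) :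
    Matrix (Fin n) (Fin n) ℝ≥0 :=
  fun i j => if i ∈ K ∧ j ∈ K then A i j else 0

/-- The nodes of all components of the digraph of `A` that contain a critical node of the
restriction of `A` to `K`. -/
def hitNodes {n : ℕ} (A : Matrix (Fin n) (Fin n) ℝ≥0) (K : Set (Fin n)) : Set (Fin n) :=
  {i | ∃ j ∈ critNodes (restrict A K), SameComp (edge A) i j}

/-- The node set `K_μ` left before step `μ`. -/
def ultK {n : ℕ} (A : Matrix (Fin n) (Fin n) ℝ≥0) : ℕ → Set (Fin n)
  | 0 => Set.univ
  | μ + 1 => ultK A μ \ hitNodes A (ultK A μ)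

/-- The matrix `A_μ`. -/
def ultA {n : ℕ} (A : Matrix (Fin n) (Fin n) ℝ≥0) (μ : ℕ) : Matrix (Fin n) (Fin n) ℝ≥0 :=
  restrict A (ultK A μ)

/-- `λ_μ`, the maximum cycle geometric mean of `A_μ`. -/
def ultLam {n : ℕ} (A : Matrix (Fin n) (Fin n) ℝ≥0) (μ : ℕ) : ℝ≥0 := mcgm (ultA A μ)

/-- The indices of the terms of the ultimate expansion. -/
def ultIndex {n : ℕ} (A : Matrix (Fin n) (Fin n) ℝ≥0) : Set ℕ := {μ | ultLam A μ ≠ 0}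

/-- `N_μ`, the node set of the critical digraph of `A_μ`. -/
def ultN {n : ℕ} (A : Matrix (Fin n) (Fin n) ℝ≥0) (μ : ℕ) : Set (Fin n) := critNodes (ultA A μ)

/-- The ultimate term `U_μ^{(t)} = C_μ S_μ^t R_μ`. -/
def ultTerm {n : ℕ} (A : Matrix (Fin n) (Fin n) ℝ≥0) (μ t : ℕ) : Matrix (Fin n) (Fin n) ℝ≥0 :=
  csr (ultA A μ) t

open scoped Classical in
/-- The joint cyclicity: the lcm of the cyclicities of the critical digraphs of all `A_μ`.
(There are at most `n` terms, as each step removes a node.) -/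
def ultCyclicity {n : ℕ} (A : Matrix (Fin n) (Fin n) ℝ≥0) : ℕ :=
  ((Finset.range n).filter fun μ => μ ∈ ultIndex A).lcm fun μ => cyclicity (critEdge (ultA A μ))

/-! ### Orbit periodicity -/

/-- The sequence `A ^ t ⊗ y` is ultimately linear periodic. -/
def UltLinPeriodic {n : ℕ} (A : Matrix (Fin n) (Fin n) ℝ≥0) (y : Fin n → ℝ≥0) : Prop :=
  ∃ r : ℝ≥0, ∃ T : ℕ, ∀ t ≥ T, ∀ i,
    mulVec (pow A (t + ultCyclicity A)) y i = r ^ ultCyclicity A * mulVec (pow A t) y i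

/-- `A` is orbit periodic. -/
def OrbitPeriodic {n : ℕ} (A : Matrix (Fin n) (Fin n) ℝ≥0) : Prop :=
  ∀ y : Fin n → ℝ≥0, UltLinPeriodic A y

end

end MaxAlg

/-! By hypothesis each node `k` on a cycle has a growth rate `r k`: its column `A^t e_k` is
eventually multiplied by `(r k)^γ°` over each period. Comparing entries along a walk from `j` to `i`
gives `r j ≤ r i` (`rate_mono`), and diagonal entries show that the rate on a component hit at step
μ is λ_μ (`rate_eq_ultLam`). Since λ_μ strictly decreases, every node with access to N_μ survives in
K_μ. Hence the support of `U_μ^{(1)} e_k`, for `k` in N_μ, consists of the nodes with a walk to `k`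
in D(A) of length `1 + m γ_μ` (`mem_supp_ultTerm_iff`).

Necessity: if `x` violates the inclusion for `i` in N_μ and `j` in N_ν, the orbit of `e_i ⊕ e_j`
must grow at rate at least λ_ν at coordinate `j`. At `x`, along the times `1 + tγ°`, column `j`
vanishes and the growth is only λ_μ (`subset_supp_of_orbitPeriodic`).

Sufficiency: shifting along critical edges turns the support condition into a statement about all
large walk lengths: a node with access to a component of smaller rate has walks of every large
length to each node of larger rate (`exists_reach_of_rate_lt`). So a faster column is eventually
positive wherever a slower one can be nonzero, and dominates it. The class `Tame` records what makes
this domination stable under maxima, and every orbit belongs to it (`exists_tame_orbit`). -/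

namespace MaxAlg

/-! ### Walks, simple cycles and cyclicity. -/

section Walks

variable {n : ℕ} {E F : Fin n → Fin n → Prop}

/-- There is a walk of length `t` from `i` to `j`. -/
def Reach (E : Fin n → Fin n → Prop) : ℕ → Fin n → Fin n → Prop
  | 0, i, j => i = j
  | t + 1, i, j => ∃ k, Reach E t i k ∧ E k j

lemma Reach.trans {s t : ℕ} {i j k : Fin n} (h : Reach E s i j) (h' : Reach E t j k) :
    Reach E (s + t) i k := by
  induction t generalizing k with
  | zero => cases h'; exact h
  | succ t ih => obtain ⟨l, hl, e⟩ := h'; exact ⟨l, ih hl, e⟩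

lemma Reach.mono (hEF : ∀ i j, E i j → F i j) {t : ℕ} {i j : Fin n} (h : Reach E t i j) :
    Reach F t i j := by
  induction t generalizing j with
  | zero => exact h
  | succ t ih => obtain ⟨l, hl, e⟩ := h; exact ⟨l, ih hl, hEF _ _ e⟩

lemma Reach.repeat {p : ℕ} {i : Fin n} (h : Reach E p i i) (m : ℕ) : Reach E (m * p) i i := by
  induction m with
  | zero => rw [zero_mul]; rfl
  | succ m ih => rw [Nat.succ_mul]; exact ih.trans h

lemma reach_one {i j : Fin n} (h : E i j) : Reach E 1 i j := ⟨i, rfl, h⟩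

lemma reach_of_path (c : ℕ → Fin n) {a b : ℕ} (hab : a ≤ b)
    (h : ∀ t, a ≤ t → t < b → E (c t) (c (t + 1))) : Reach E (b - a) (c a) (c b) := by
  induction b, hab using Nat.le_induction with
  | base => rw [Nat.sub_self]; rfl
  | succ b hb ih =>
    rw [Nat.succ_sub hb]
    exact ⟨c b, ih fun t h1 h2 => h t h1 (by omega), h b hb (by omega)⟩

lemma Reach.exists_path {t : ℕ} {i j : Fin n} (h : Reach E t i j) :
    ∃ c : ℕ → Fin n, c 0 = i ∧ c t = j ∧ ∀ s < t, E (c s) (c (s + 1)) := by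
  induction t generalizing j with
  | zero => exact ⟨fun _ => i, rfl, h, by simp⟩
  | succ t ih =>
    obtain ⟨k, hk, e⟩ := h
    obtain ⟨c, h0, ht, hc⟩ := ih hk
    refine ⟨fun s => if s ≤ t then c s else j, by simpa using h0, by simp, fun s hs => ?_⟩
    rcases Nat.lt_succ_iff_lt_or_eq.1 hs with h | rfl
    · simpa [h.le, Nat.succ_le_of_lt h] using hc s h
    · simpa [ht] using e

lemma reflTransGen_iff_reach {i j : Fin n} :
    Relation.ReflTransGen E i j ↔ ∃ t, Reach E t i j := by
  constructor
  · intro h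
    induction h with
    | refl => exact ⟨0, rfl⟩
    | tail _ e ih => obtain ⟨t, ht⟩ := ih; exact ⟨t + 1, _, ht, e⟩
  · rintro ⟨t, h⟩
    induction t generalizing j with
    | zero => cases h; exact .refl
    | succ t ih => obtain ⟨k, hk, e⟩ := h; exact (ih hk).tail e

lemma Reach.rtg {t : ℕ} {i j : Fin n} (h : Reach E t i j) : Relation.ReflTransGen E i j :=
  reflTransGen_iff_reach.2 ⟨t, h⟩

lemma SameComp.refl (i : Fin n) : SameComp E i i := ⟨.refl, .refl⟩

lemma SameComp.trans {i j k : Fin n} (h : SameComp E i j) (h' : SameComp E j k) :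
    SameComp E i k := ⟨h.1.trans h'.1, h'.2.trans h.2⟩

lemma IsCycle.reach_self {k t : ℕ} {c : ℕ → Fin n} (h : IsCycle E k c) (ht : t < k) :
    Reach E k (c t) (c t) := by
  have h1 := reach_of_path (E := E) c ht.le fun s _ hs => h.edges s hs
  have h2 := reach_of_path (E := E) c (Nat.zero_le t) fun s _ hs => h.edges s (hs.trans ht)
  rw [h.closed] at h1
  have := h1.trans h2
  rwa [Nat.sub_zero, Nat.sub_add_cancel ht.le] at this

lemma onCycle_iff {i : Fin n} : OnCycle E i ↔ ∃ p, 1 ≤ p ∧ Reach E p i i := by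
  constructor
  · rintro ⟨k, c, hc, t, ht, rfl⟩
    exact ⟨k, hc.pos, hc.reach_self ht⟩
  · rintro ⟨p, hp, h⟩
    obtain ⟨c, h0, h1, hc⟩ := h.exists_path
    exact ⟨p, c, ⟨hp, h1.trans h0.symm, hc⟩, 0, hp, h0⟩

/-- A shortest closed walk in the component is simple, since a repeated node would cut out a shorter
one. -/
lemma OnCycle.exists_simple {i : Fin n} (h : OnCycle E i) :
    ∃ k c, k ≤ n ∧ IsSimpleCycle E k c ∧ SameComp E (c 0) i := by
  classical
  obtain ⟨p, hp, h⟩ := onCycle_iff.1 h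
  have hex : ∃ k, 1 ≤ k ∧ ∃ a, SameComp E a i ∧ Reach E k a a := ⟨p, hp, i, .refl i, h⟩
  obtain ⟨hk, a, ha, hr⟩ := Nat.find_spec hex
  have hmin := fun m (hm : m < Nat.find hex) => Nat.find_min hex hm
  generalize Nat.find hex = k at hk hr hmin
  obtain ⟨c, h0, h1, hc⟩ := hr.exists_path
  have key : ∀ s t, s < t → t < k → c s ≠ c t := by
    intro s t hst htk heq
    have r1 := reach_of_path (E := E) c hst.le fun u _ hu => hc u (hu.trans htk)
    rw [← heq] at r1
    have r2 := reach_of_path (E := E) c (Nat.zero_le s)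
      fun u _ hu => hc u (hu.trans (hst.trans htk))
    have r3 := reach_of_path (E := E) c (hst.trans htk).le fun u _ hu => hc u hu
    rw [h0] at r2
    rw [h1] at r3
    exact hmin (t - s) (by omega) ⟨by omega, c s, .trans ⟨r3.rtg, r2.rtg⟩ ha, r1⟩
  have hinj : Set.InjOn c (Set.Iio k) := by
    intro s hs t ht heq
    rcases lt_trichotomy s t with h | h | h
    · exact absurd heq (key s t h ht)
    · exact h
    · exact absurd heq.symm (key t s h hs)
  refine ⟨k, c, ?_, ⟨⟨hk, h1.trans h0.symm, hc⟩, hinj⟩, h0 ▸ ha⟩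
  have := Finset.card_le_card_of_injOn (s := Finset.range k) (t := Finset.univ) c (by simp)
    (by simpa using hinj)
  simpa using this

lemma compCyclicity_ne_zero {i : Fin n} (h : OnCycle E i) : compCyclicity E i ≠ 0 := by
  obtain ⟨k, c, hk, hc, hs⟩ := h.exists_simple
  intro h0
  have : k = 0 := by
    refine Finset.gcd_eq_zero_iff.1 h0 k ?_
    simp only [Finset.mem_filter, Finset.mem_range]
    exact ⟨by omega, c, hc, hs⟩
  have := hc.1.pos
  omega

lemma cyclicity_pos : 0 < cyclicity E := by
  classical
  rw [Nat.pos_iff_ne_zero, cyclicity, Ne, Finset.lcm_eq_zero_iff]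
  rintro ⟨i, hi, h0⟩
  exact compCyclicity_ne_zero (by simpa using hi) h0

/-- The lengths of closed walks at `i` form a submonoid of ℕ, which contains all large multiples of
its gcd. This gcd divides the length `k` of any simple cycle in the component: a round trip from `i`
with and without the cycle gives two lengths differing by `k`. -/
lemma OnCycle.exists_reach_mul_cyclicity {i : Fin n} (h : OnCycle E i) :
    ∃ L, ∀ m ≥ L, Reach E (m * cyclicity E) i i := by
  classical
  set H : AddSubmonoid ℕ :=
    { carrier := {t | Reach E t i i}
      zero_mem' := rfl
      add_mem' := fun h h' => Reach.trans h h' }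
  have hdvd : Nat.setGcd (H : Set ℕ) ∣ cyclicity E := by
    refine dvd_trans ?_ (Finset.dvd_lcm (f := compCyclicity E) (b := i) (by simpa using h))
    refine Finset.dvd_gcd fun k hk => ?_
    simp only [Finset.mem_filter] at hk
    obtain ⟨-, c, hc, h1, h2⟩ := hk
    obtain ⟨a, ha⟩ := reflTransGen_iff_reach.1 h1
    obtain ⟨b, hb⟩ := reflTransGen_iff_reach.1 h2
    have m1 : b + a ∈ (H : Set ℕ) := hb.trans ha
    have m2 : b + k + a ∈ (H : Set ℕ) := (hb.trans (hc.1.reach_self hc.1.pos)).trans ha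
    have := Nat.dvd_sub (Nat.setGcd_dvd_of_mem m2) (Nat.setGcd_dvd_of_mem m1)
    rwa [show b + k + a - (b + a) = k by omega] at this
  obtain ⟨L, hL⟩ := Nat.exists_mem_closure_of_ge (H : Set ℕ)
  refine ⟨L, fun m hm => ?_⟩
  have := hL (m * cyclicity E) (hm.trans (Nat.le_mul_of_pos_right _ cyclicity_pos))
    (hdvd.mul_left _)
  rwa [AddSubmonoid.closure_eq] at this

end Walks

/-! ### Max-algebraic powers as maximal walk weights. -/

section Powers

variable {n : ℕ} {A B : Matrix (Fin n) (Fin n) ℝ≥0}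

lemma mul_apply_ne_zero {i j : Fin n} : mul A B i j ≠ 0 ↔ ∃ k, A i k ≠ 0 ∧ B k j ≠ 0 := by
  rw [mul, ← bot_eq_zero, Ne, Finset.sup_eq_bot_iff]
  simp [not_or]

lemma le_mul_apply (i k j : Fin n) : A i k * B k j ≤ mul A B i j :=
  Finset.le_sup (f := fun k => A i k * B k j) (Finset.mem_univ k)

lemma mul_assoc' (A B C : Matrix (Fin n) (Fin n) ℝ≥0) :
    mul (mul A B) C = mul A (mul B C) := by
  funext i j
  simp only [mul, NNReal.mul_finset_sup, NNReal.finset_sup_mul]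
  rw [Finset.sup_comm]
  simp only [mul_assoc]

lemma mul_one' (A : Matrix (Fin n) (Fin n) ℝ≥0) : mul A 1 = A := by
  funext i j
  apply le_antisymm
  · refine Finset.sup_le fun k _ => ?_
    by_cases h : k = j
    · subst h; simp
    · simp [Matrix.one_apply_ne h]
  · simpa using le_mul_apply (A := A) (B := 1) i j j

lemma one_mul' (A : Matrix (Fin n) (Fin n) ℝ≥0) : mul 1 A = A := by
  funext i j
  apply le_antisymm
  · refine Finset.sup_le fun k _ => ?_
    by_cases h : i = k
    · subst h; simp
    · simp [Matrix.one_apply_ne h]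
  · simpa using le_mul_apply (A := 1) (B := A) i i j

lemma pow_add' (A : Matrix (Fin n) (Fin n) ℝ≥0) (s t : ℕ) :
    pow A (s + t) = mul (pow A s) (pow A t) := by
  induction t with
  | zero => simp [pow, mul_one']
  | succ t ih => rw [← add_assoc, pow, ih, mul_assoc', pow]

lemma pow_one' (A : Matrix (Fin n) (Fin n) ℝ≥0) : pow A 1 = A := one_mul' A

lemma pow_pow (A : Matrix (Fin n) (Fin n) ℝ≥0) (s t : ℕ) : pow (pow A s) t = pow A (t * s) := by
  induction t with
  | zero => simp [pow]
  | succ t ih => rw [Nat.succ_mul, pow_add' A, ← ih]; rfl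

lemma pow_mul_le (A : Matrix (Fin n) (Fin n) ℝ≥0) (s t : ℕ) (i j k : Fin n) :
    pow A s i j * pow A t j k ≤ pow A (s + t) i k := by
  rw [pow_add']; exact le_mul_apply i j k

lemma pow_self_le (A : Matrix (Fin n) (Fin n) ℝ≥0) (s m : ℕ) (i : Fin n) :
    pow A s i i ^ m ≤ pow A (m * s) i i := by
  induction m with
  | zero => simp [pow]
  | succ m ih =>
    rw [pow_succ, Nat.succ_mul]
    exact (mul_le_mul_left ih _).trans (pow_mul_le A _ _ i i i)

lemma pow_ne_zero_iff_reach {t : ℕ} {i j : Fin n} : pow A t i j ≠ 0 ↔ Reach (edge A) t i j := by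
  induction t generalizing j with
  | zero => simp [pow, Reach, Matrix.one_apply]
  | succ t ih => simp only [pow, mul_apply_ne_zero, Reach, ih, edge]

lemma pow_mono (h : ∀ i j, A i j ≤ B i j) (t : ℕ) (i j : Fin n) : pow A t i j ≤ pow B t i j := by
  induction t generalizing j with
  | zero => exact le_rfl
  | succ t ih => exact Finset.sup_mono_fun fun k _ => mul_le_mul' (ih k) (h k j)

lemma prod_le_pow (A : Matrix (Fin n) (Fin n) ℝ≥0) (c : ℕ → Fin n) {a b : ℕ} (hab : a ≤ b) :
    ∏ t ∈ Finset.Ico a b, A (c t) (c (t + 1)) ≤ pow A (b - a) (c a) (c b) := by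
  induction b, hab using Nat.le_induction with
  | base => simp [pow]
  | succ b hb ih =>
    rw [Finset.prod_Ico_succ_top hb, Nat.succ_sub hb]
    exact (mul_le_mul_left ih _).trans (le_mul_apply _ _ _)

lemma weight_eq_prod_Ico (A : Matrix (Fin n) (Fin n) ℝ≥0) (t : ℕ) (c : ℕ → Fin n) :
    weight A t c = ∏ t ∈ Finset.Ico 0 t, A (c t) (c (t + 1)) := by
  rw [weight, Finset.range_eq_Ico]

lemma weight_ne_zero_iff {t : ℕ} {c : ℕ → Fin n} :
    weight A t c ≠ 0 ↔ ∀ s < t, edge A (c s) (c (s + 1)) := by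
  simp [weight, Finset.prod_eq_zero_iff, edge]

lemma exists_optimal_path {t : ℕ} {i j : Fin n} (h : pow A t i j ≠ 0) :
    ∃ c : ℕ → Fin n, c 0 = i ∧ c t = j ∧ weight A t c = pow A t i j := by
  induction t generalizing j with
  | zero =>
    have hij := pow_ne_zero_iff_reach.1 h
    cases hij
    exact ⟨fun _ => i, rfl, rfl, by simp [weight, pow]⟩
  | succ t ih =>
    obtain ⟨k, -, hk⟩ := Finset.exists_mem_eq_sup Finset.univ ⟨i, Finset.mem_univ i⟩
      fun k => pow A t i k * A k j
    have hk : pow A (t + 1) i j = pow A t i k * A k j := hk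
    obtain ⟨c, h0, ht, hc⟩ := ih (j := k) (left_ne_zero_of_mul (hk ▸ h))
    refine ⟨fun s => if s ≤ t then c s else j, by simpa using h0, by simp, ?_⟩
    rw [hk, ← hc, weight, weight, Finset.prod_range_succ]
    congr 1
    · refine Finset.prod_congr rfl fun s hs => ?_
      have := Finset.mem_range.1 hs
      simp [this.le, Nat.succ_le_of_lt this]
    · simp [ht]

lemma mulVec_unitVec (M : Matrix (Fin n) (Fin n) ℝ≥0) (i x : Fin n) :
    mulVec M (unitVec i) x = M x i := by
  apply le_antisymm
  · refine Finset.sup_le fun k _ => ?_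
    by_cases h : k = i
    · subst h; simp [unitVec]
    · simp [unitVec, h]
  · simpa [unitVec, mulVec] using Finset.le_sup (f := fun k => M x k * unitVec i k) (Finset.mem_univ i)

end Powers

/-! ### The maximum cycle geometric mean and the growth of powers. -/

section CycleMean

variable {n : ℕ} {A : Matrix (Fin n) (Fin n) ℝ≥0}

lemma geoMean_pow {k : ℕ} (hk : 1 ≤ k) (c : ℕ → Fin n) : geoMean A k c ^ k = weight A k c := by
  have hk' : (k : ℝ) ≠ 0 := by positivity
  rw [geoMean, ← NNReal.rpow_natCast, ← NNReal.rpow_mul, one_div_mul_cancel hk', NNReal.rpow_one]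

lemma IsCycle.geoMean_ne_zero {k : ℕ} {c : ℕ → Fin n} (h : IsCycle (edge A) k c) :
    geoMean A k c ≠ 0 := by
  intro h0
  apply weight_ne_zero_iff.2 h.edges
  rw [← geoMean_pow h.pos, h0, zero_pow (by have := h.pos; omega)]

/-- The geometric mean of a cycle of length at most `n` depends only on `c 0, …, c n`. -/
lemma finite_geoMeans (A : Matrix (Fin n) (Fin n) ℝ≥0) :
    {x | ∃ k c, k ≤ n ∧ IsCycle (edge A) k c ∧ x = geoMean A k c}.Finite := by
  refine (Set.finite_range fun p : Fin (n + 1) × (Fin (n + 1) → Fin n) =>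
    geoMean A p.1 fun t => p.2 ⟨min t n, by omega⟩).subset ?_
  rintro x ⟨k, c, hk, -, rfl⟩
  refine ⟨⟨⟨k, by omega⟩, fun t => c t⟩, ?_⟩
  simp only [geoMean, weight]
  congr 1
  refine Finset.prod_congr rfl fun t ht => ?_
  have := Finset.mem_range.1 ht
  rw [min_eq_left (by omega), min_eq_left (by omega)]

lemma geoMean_le_mcgm {k : ℕ} {c : ℕ → Fin n} (hk : k ≤ n) (h : IsCycle (edge A) k c) :
    geoMean A k c ≤ mcgm A :=
  le_csSup (finite_geoMeans A).bddAbove ⟨k, c, hk, h, rfl⟩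

lemma weight_le_mcgm_pow {k : ℕ} {c : ℕ → Fin n} (hk : k ≤ n) (h : IsCycle (edge A) k c) :
    weight A k c ≤ mcgm A ^ k := by
  rw [← geoMean_pow h.pos]; exact pow_le_pow_left₀ (zero_le) (geoMean_le_mcgm hk h) k

lemma exists_critCycle (h : mcgm A ≠ 0) : ∃ k c, k ≤ n ∧ IsCritCycle A k c := by
  have hne : {x | ∃ k c, k ≤ n ∧ IsCycle (edge A) k c ∧ x = geoMean A k c}.Nonempty := by
    by_contra hne
    rw [Set.not_nonempty_iff_eq_empty] at hne
    exact h (by rw [mcgm, hne]; simp)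
  obtain ⟨k, c, hk, hc, hx⟩ := hne.csSup_mem (finite_geoMeans A)
  exact ⟨k, c, hk, hc, hx.symm⟩

lemma OnCycle.mcgm_ne_zero {i : Fin n} (h : OnCycle (edge A) i) : mcgm A ≠ 0 := by
  obtain ⟨k, c, hk, hc, -⟩ := h.exists_simple
  intro h0
  exact hc.1.geoMean_ne_zero (le_zero_iff.1 (h0 ▸ geoMean_le_mcgm hk hc.1))

lemma mcgm_ne_zero_of_mem_critNodes {i : Fin n} (h : i ∈ critNodes A) : mcgm A ≠ 0 := by
  obtain ⟨k, c, hc, -⟩ := h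
  rw [← hc.2]; exact hc.1.geoMean_ne_zero

lemma critNodes_nonempty (h : mcgm A ≠ 0) : (critNodes A).Nonempty := by
  obtain ⟨k, c, -, hc⟩ := exists_critCycle h
  exact ⟨c 0, k, c, hc, 0, hc.1.pos, rfl⟩

/-- A diagonal entry at a critical node attains the maximum cycle geometric mean. -/
lemma exists_mcgm_pow_le {i : Fin n} (h : i ∈ critNodes A) :
    ∃ p, 1 ≤ p ∧ mcgm A ^ p ≤ pow A p i i := by
  obtain ⟨k, c, hc, t, ht, rfl⟩ := h
  refine ⟨k, hc.1.pos, ?_⟩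
  rw [← hc.2, geoMean_pow hc.1.pos, weight_eq_prod_Ico,
    ← Finset.prod_Ico_consecutive _ (Nat.zero_le t) ht.le, mul_comm]
  refine (mul_le_mul' (prod_le_pow A c ht.le) (prod_le_pow A c (Nat.zero_le t))).trans ?_
  rw [hc.1.closed]
  refine (pow_mul_le A _ _ _ _ _).trans ?_
  rw [Nat.sub_zero, Nat.sub_add_cancel ht.le]

/-- Removing a cycle from a long walk shows that `A ^ t` grows at most as fast as `mcgm A ^ t`. -/
lemma exists_pow_le (h : mcgm A ≠ 0) : ∃ C, ∀ t i j, pow A t i j ≤ C * mcgm A ^ t := by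
  set l := mcgm A with hl
  set C : ℝ≥0 := (Finset.range n ×ˢ (Finset.univ : Finset (Fin n × Fin n))).sup
    fun p => pow A p.1 p.2.1 p.2.2 / l ^ p.1
  refine ⟨C, fun t => ?_⟩
  induction t using Nat.strong_induction_on with
  | _ t ih =>
  intro i j
  rcases lt_or_ge t n with ht | ht
  · rw [← div_le_iff₀ (pow_pos (pos_iff_ne_zero.2 h) t)]
    exact Finset.le_sup (s := Finset.range n ×ˢ (Finset.univ : Finset (Fin n × Fin n)))
      (f := fun p => pow A p.1 p.2.1 p.2.2 / l ^ p.1) (b := (t, i, j)) (by simpa using ht)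
  by_cases h0 : pow A t i j = 0
  · rw [h0]; exact zero_le
  obtain ⟨c, rfl, rfl, hc⟩ := exists_optimal_path h0
  -- Pigeonhole on the first `n + 1` nodes keeps the excised cycle of length at most `n`, as `mcgm`
  -- requires.
  obtain ⟨a, b, hab, hbn, heq⟩ : ∃ a b, a < b ∧ b ≤ n ∧ c a = c b := by
    obtain ⟨x, y, hxy, he⟩ := Fintype.exists_ne_map_eq_of_card_lt
      (fun s : Fin (n + 1) => c s) (by simp)
    rcases lt_or_gt_of_ne hxy with h | h
    · exact ⟨x, y, h, by omega, he⟩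
    · exact ⟨y, x, h, by omega, he.symm⟩
  have hedge := weight_ne_zero_iff.1 (hc ▸ h0)
  have hcyc : IsCycle (edge A) (b - a) (fun s => c (a + s)) :=
    ⟨by omega, by simp [heq, Nat.add_sub_cancel' hab.le], fun s hs => hedge (a + s) (by omega)⟩
  have hmid : ∏ s ∈ Finset.Ico a b, A (c s) (c (s + 1)) ≤ l ^ (b - a) := by
    have := weight_le_mcgm_pow (by omega) hcyc
    rwa [Finset.prod_Ico_eq_prod_range]
  rw [← hc, weight_eq_prod_Ico, ← Finset.prod_Ico_consecutive _ (Nat.zero_le b) (hbn.trans ht),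
    ← Finset.prod_Ico_consecutive _ (Nat.zero_le a) hab.le]
  have h1 := prod_le_pow A c (Nat.zero_le a)
  have h2 := prod_le_pow A c (hbn.trans ht)
  rw [← heq] at h2
  have h3 := (mul_le_mul' h1 h2).trans (pow_mul_le A _ _ _ _ _)
  have h4 := h3.trans (ih (a - 0 + (t - b)) (by omega) _ _)
  calc _ = (∏ s ∈ Finset.Ico 0 a, A (c s) (c (s + 1))) *
        (∏ s ∈ Finset.Ico b t, A (c s) (c (s + 1))) *
          ∏ s ∈ Finset.Ico a b, A (c s) (c (s + 1)) := by ring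
    _ ≤ C * l ^ (a - 0 + (t - b)) * l ^ (b - a) := mul_le_mul' h4 hmid
    _ = C * l ^ t := by rw [mul_assoc, ← pow_add]; congr 2; omega

end CycleMean

/-! ### Supports of CSR products. -/

section CSR

variable {n : ℕ} {A : Matrix (Fin n) (Fin n) ℝ≥0}

lemma critEdge.edge {i j : Fin n} (h : critEdge A i j) : edge A i j := by
  obtain ⟨k, c, hc, t, ht, rfl, rfl⟩ := h
  exact hc.1.edges t ht

lemma critEdge.left_mem {i j : Fin n} (h : critEdge A i j) : i ∈ critNodes A := by
  obtain ⟨k, c, hc, t, ht, rfl, rfl⟩ := h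
  exact ⟨k, c, hc, t, ht, rfl⟩

lemma critEdge.right_mem {i j : Fin n} (h : critEdge A i j) : j ∈ critNodes A := by
  obtain ⟨k, c, hc, t, ht, rfl, rfl⟩ := h
  rcases Nat.lt_or_ge (t + 1) k with h | h
  · exact ⟨k, c, hc, t + 1, h, rfl⟩
  · exact ⟨k, c, hc, 0, hc.1.pos, by rw [← hc.1.closed]; congr 1; omega⟩

lemma onCycle_critEdge {i : Fin n} (h : i ∈ critNodes A) : OnCycle (critEdge A) i := by
  obtain ⟨k, c, hc, t, ht, rfl⟩ := h
  exact ⟨k, c, ⟨hc.1.pos, hc.1.closed, fun s hs => ⟨k, c, hc, s, hs, rfl, rfl⟩⟩, t, ht, rfl⟩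

lemma onCycle_edge {i : Fin n} (h : i ∈ critNodes A) : OnCycle (edge A) i := by
  obtain ⟨k, c, hc, ht⟩ := h
  exact ⟨k, c, hc.1, ht⟩

lemma exists_critEdge_to {i : Fin n} (h : i ∈ critNodes A) : ∃ j, critEdge A j i := by
  obtain ⟨p, hp, hr⟩ := onCycle_iff.1 (onCycle_critEdge h)
  obtain ⟨q, rfl⟩ := Nat.exists_eq_add_of_le' hp
  obtain ⟨j, -, e⟩ := hr
  exact ⟨j, e⟩

lemma exists_critEdge_from {i : Fin n} (h : i ∈ critNodes A) : ∃ j, critEdge A i j := by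
  obtain ⟨k, c, hc, t, ht, rfl⟩ := h
  exact ⟨c (t + 1), k, c, hc, t, ht, rfl, rfl⟩

lemma exists_critNode_reach_from {i : Fin n} (h : i ∈ critNodes A) (s : ℕ) :
    ∃ j ∈ critNodes A, Reach (edge A) s i j := by
  induction s with
  | zero => exact ⟨i, h, rfl⟩
  | succ s ih =>
    obtain ⟨j, hj, hr⟩ := ih
    obtain ⟨k, e⟩ := exists_critEdge_from hj
    exact ⟨k, e.right_mem, j, hr, e.edge⟩

lemma exists_critNode_reach_to {i : Fin n} (h : i ∈ critNodes A) (s : ℕ) :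
    ∃ j ∈ critNodes A, Reach (edge A) s j i := by
  induction s with
  | zero => exact ⟨i, h, rfl⟩
  | succ s ih =>
    obtain ⟨j, hj, hr⟩ := ih
    obtain ⟨k, e⟩ := exists_critEdge_to hj
    exact ⟨k, e.left_mem, by rw [add_comm]; exact (reach_one e.edge).trans hr⟩

lemma pow_normalize (A : Matrix (Fin n) (Fin n) ℝ≥0) (t : ℕ) (i j : Fin n) :
    pow (normalize A) t i j = pow A t i j / mcgm A ^ t := by
  induction t generalizing j with
  | zero => simp [pow]
  | succ t ih =>
    simp only [pow, mul, ih, normalize, pow_succ]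
    rw [div_eq_mul_inv, NNReal.finset_sup_mul]
    refine Finset.sup_congr rfl fun k _ => ?_
    rw [div_mul_div_comm, div_eq_mul_inv]

lemma starB_ne_zero_iff (h : mcgm A ≠ 0) {i j : Fin n} :
    starB A i j ≠ 0 ↔ ∃ m, Reach (edge A) (m * cyclicity (critEdge A)) i j := by
  have key (m : ℕ) : pow (pow (normalize A) (cyclicity (critEdge A))) m i j
      = pow A (m * cyclicity (critEdge A)) i j / mcgm A ^ (m * cyclicity (critEdge A)) := by
    rw [pow_pow, pow_normalize]
  simp only [← pow_ne_zero_iff_reach]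
  constructor
  · intro h0
    by_contra! hz
    apply h0
    simp [starB, kleeneStar, key, hz]
  · rintro ⟨m, hm⟩
    -- Boundedness is essential: the supremum of an unbounded family in `ℝ≥0` is `0` by convention.
    obtain ⟨C, hC⟩ := exists_pow_le h
    have hb : BddAbove (Set.range fun t =>
        pow (pow (normalize A) (cyclicity (critEdge A))) t i j) := by
      refine ⟨C, ?_⟩
      rintro _ ⟨t, rfl⟩
      simp only [key]
      rw [div_le_iff₀ (pow_pos (pos_iff_ne_zero.2 h) _)]
      exact hC _ _ _
    refine ne_of_gt (lt_of_lt_of_le ?_ (le_ciSup hb m))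
    rw [key]
    exact div_pos (pos_iff_ne_zero.2 hm) (pow_pos (pos_iff_ne_zero.2 h) _)

/-- The support of a column of `C S R` at a critical node. -/
lemma csr_one_ne_zero_iff {j k : Fin n} (hk : k ∈ critNodes A) :
    csr A 1 j k ≠ 0 ↔ ∃ m, Reach (edge A) (1 + m * cyclicity (critEdge A)) j k := by
  have h := mcgm_ne_zero_of_mem_critNodes hk
  simp only [csr, mul_apply_ne_zero, pow_one']
  constructor
  · rintro ⟨b, ⟨a, hC, hS⟩, hR⟩
    have ha : starB A j a ≠ 0 := fun h0 => hC (by simp [matC, h0])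
    have hb : starB A b k ≠ 0 := fun h0 => hR (by simp [matR, h0])
    have he : critEdge A a b := by
      by_contra h0; exact hS (by simp [matS, h0])
    obtain ⟨s, hs⟩ := (starB_ne_zero_iff h).1 ha
    obtain ⟨t, ht⟩ := (starB_ne_zero_iff h).1 hb
    refine ⟨s + t, ?_⟩
    have := (hs.trans (reach_one he.edge)).trans ht
    convert this using 1
    ring
  · rintro ⟨m, hm⟩
    -- A closed critical walk at `k` of length a positive multiple of the cyclicity is appended. Its
    -- last edge supplies the factor `S`, everything before it goes into `C`, and `R` contributes
    -- its diagonal entry.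
    obtain ⟨L, hL⟩ := (onCycle_critEdge hk).exists_reach_mul_cyclicity
    have hr := hL (L + 1) (by omega)
    obtain ⟨s, hs⟩ := Nat.exists_eq_add_of_le'
      (Nat.mul_pos (Nat.succ_pos L) (cyclicity_pos (E := critEdge A)))
    rw [hs] at hr
    obtain ⟨p, hp, e⟩ := hr
    have hp := hp.mono fun _ _ h => critEdge.edge h
    refine ⟨k, ⟨p, ?_, ?_⟩, ?_⟩
    · rw [matC, if_pos e.left_mem, starB_ne_zero_iff h]
      refine ⟨m + (L + 1), ?_⟩
      have := hm.trans hp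
      rw [add_mul, hs]
      convert this using 1
      ring
    · rw [matS, if_pos e, normalize]
      exact div_ne_zero e.edge h
    · rw [matR, if_pos hk, starB_ne_zero_iff h]
      exact ⟨0, by rw [zero_mul]; rfl⟩

end CSR

/-! ### Structure of the ultimate expansion. -/

section UltimateExpansion

variable {n : ℕ} {A : Matrix (Fin n) (Fin n) ℝ≥0} {K : Set (Fin n)}

lemma edge_restrict {i j : Fin n} : edge (restrict A K) i j ↔ (i ∈ K ∧ j ∈ K) ∧ edge A i j := by
  simp [edge, restrict, and_assoc]

lemma restrict_le (A : Matrix (Fin n) (Fin n) ℝ≥0) (K : Set (Fin n)) (i j : Fin n) :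
    restrict A K i j ≤ A i j := by
  unfold restrict
  split_ifs
  · exact le_rfl
  · exact zero_le

lemma weight_restrict {k : ℕ} {c : ℕ → Fin n} (h : ∀ t ≤ k, c t ∈ K) :
    weight (restrict A K) k c = weight A k c := by
  refine Finset.prod_congr rfl fun t ht => ?_
  have := Finset.mem_range.1 ht
  rw [restrict, if_pos ⟨h _ this.le, h _ this⟩]

lemma critNodes_restrict_subset : critNodes (restrict A K) ⊆ K := by
  intro i hi
  obtain ⟨j, e⟩ := exists_critEdge_from hi
  exact (edge_restrict.1 e.edge).1.1

lemma critNodes_subset_hitNodes : critNodes (restrict A K) ⊆ hitNodes A K :=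
  fun i hi => ⟨i, hi, .refl i⟩

lemma mem_ultK_of_sameComp {μ : ℕ} {i j : Fin n} (h : SameComp (edge A) i j)
    (hi : i ∈ ultK A μ) : j ∈ ultK A μ := by
  induction μ with
  | zero => trivial
  | succ μ ih =>
    refine ⟨ih hi.1, ?_⟩
    rintro ⟨k, hk, hjk⟩
    exact hi.2 ⟨k, hk, h.trans hjk⟩

lemma ultK_antitone : Antitone (ultK A) := antitone_nat_of_succ_le fun _ => Set.sdiff_subset

lemma exists_hit_of_notMem_ultK {μ : ℕ} {i : Fin n} (h : i ∉ ultK A μ) :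
    ∃ ν < μ, i ∈ hitNodes A (ultK A ν) := by
  induction μ with
  | zero => exact absurd trivial h
  | succ μ ih =>
    by_cases hi : i ∈ ultK A μ
    · exact ⟨μ, by omega, by_contra fun h' => h ⟨hi, h'⟩⟩
    · obtain ⟨ν, hν, h⟩ := ih hi
      exact ⟨ν, by omega, h⟩

/-- A critical cycle of `A_μ` is also a cycle of `A_ν`; with mean λ_ν it would have been removed at
step `ν`. -/
lemma ultLam_lt {μ ν : ℕ} (hνμ : ν < μ) (hμ : ultLam A μ ≠ 0) : ultLam A μ < ultLam A ν := by
  obtain ⟨k, c, hk, hc, hgeo⟩ := exists_critCycle hμ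
  have hsub : ultK A μ ⊆ ultK A ν := ultK_antitone hνμ.le
  have hmem : ∀ t < k, c t ∈ ultK A μ := fun t ht => (edge_restrict.1 (hc.edges t ht)).1.1
  have hmem' : ∀ t ≤ k, c t ∈ ultK A μ := by
    intro t ht
    rcases ht.lt_or_eq with h | rfl
    · exact hmem t h
    · rw [hc.closed]; exact hmem 0 hc.pos
  have hcyc : IsCycle (edge (ultA A ν)) k c := ⟨hc.pos, hc.closed, fun t ht =>
    edge_restrict.2 ⟨⟨hsub (hmem' _ ht.le), hsub (hmem' _ ht)⟩,
      (edge_restrict.1 (hc.edges t ht)).2⟩⟩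
  have heq : geoMean (ultA A ν) k c = ultLam A μ := by
    rw [ultLam, ← hgeo, geoMean, geoMean, ultA, ultA, weight_restrict hmem',
      weight_restrict fun t ht => hsub (hmem' t ht)]
  refine lt_of_le_of_ne (heq ▸ geoMean_le_mcgm hk hcyc) fun h => ?_
  have h1 : c 0 ∈ critNodes (ultA A ν) := ⟨k, c, ⟨hcyc, heq.trans h⟩, 0, hc.pos, rfl⟩
  have h2 : c 0 ∈ ultK A (ν + 1) := ultK_antitone (A := A) hνμ (hmem 0 hc.pos)
  exact h2.2 (critNodes_subset_hitNodes h1)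

lemma ncard_ultK_add_le {μ : ℕ} (hμ : ultLam A μ ≠ 0) : (ultK A μ).ncard + μ ≤ n := by
  induction μ with
  | zero => simp [ultK]
  | succ μ ih =>
    have hlam : ultLam A μ ≠ 0 := ((zero_le).trans_lt (ultLam_lt μ.lt_succ_self hμ)).ne'
    have := ih hlam
    obtain ⟨i, hi⟩ := critNodes_nonempty hlam
    have hlt : (ultK A (μ + 1)).ncard < (ultK A μ).ncard := by
      refine Set.ncard_lt_ncard ⟨Set.sdiff_subset, fun h => ?_⟩
      exact (h (critNodes_restrict_subset hi)).2 (critNodes_subset_hitNodes hi)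
    omega

lemma lt_of_mem_ultIndex {μ : ℕ} (hμ : μ ∈ ultIndex A) : μ < n := by
  have := ncard_ultK_add_le hμ
  obtain ⟨i, hi⟩ := critNodes_nonempty hμ
  have := (Set.ncard_pos (Set.toFinite _)).2 ⟨i, critNodes_restrict_subset hi⟩
  have h : 0 < (ultK A μ).ncard := this
  omega

lemma ultCyclicity_pos : 0 < ultCyclicity A := by
  classical
  rw [Nat.pos_iff_ne_zero, ultCyclicity, Ne, Finset.lcm_eq_zero_iff]
  rintro ⟨i, -, h0⟩
  exact cyclicity_pos.ne' h0

lemma cyclicity_dvd_ultCyclicity {μ : ℕ} (hμ : μ ∈ ultIndex A) :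
    cyclicity (critEdge (ultA A μ)) ∣ ultCyclicity A :=
  Finset.dvd_lcm (f := fun μ => cyclicity (critEdge (ultA A μ)))
    (by simpa using ⟨lt_of_mem_ultIndex hμ, hμ⟩)

lemma sameComp_of_closed_path {E : Fin n → Fin n → Prop} {t : ℕ} {c : ℕ → Fin n}
    (hc : c t = c 0) (h : ∀ s < t, E (c s) (c (s + 1))) {s : ℕ} (hs : s ≤ t) :
    SameComp E (c 0) (c s) := by
  have h1 := reach_of_path (E := E) c (Nat.zero_le s) fun u _ hu => h u (by omega)
  have h2 := reach_of_path (E := E) c hs fun u _ hu => h u hu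
  rw [hc] at h2
  exact ⟨h1.rtg, h2.rtg⟩

/-- A closed walk never leaves its component, and `K` is a union of components. -/
lemma pow_restrict_self (hK : ∀ i j, SameComp (edge A) i j → i ∈ K → j ∈ K) {i : Fin n}
    (hi : i ∈ K) (t : ℕ) : pow (restrict A K) t i i = pow A t i i := by
  apply le_antisymm (pow_mono (restrict_le A K) t i i)
  by_cases h0 : pow A t i i = 0
  · rw [h0]; exact zero_le
  obtain ⟨c, rfl, ht, hc⟩ := exists_optimal_path h0
  rw [← hc, ← weight_restrict (K := K), weight_eq_prod_Ico]
  · have := prod_le_pow (restrict A K) c (Nat.zero_le t)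
    rwa [ht] at this
  · exact fun s hs => hK _ _
      (sameComp_of_closed_path ht (weight_ne_zero_iff.1 (hc ▸ h0)) hs) hi

/-- A component never hit would keep a cycle in `A_n`, although every index of the expansion is
below `n`. -/
lemma OnCycle.exists_hit {i : Fin n} (h : OnCycle (edge A) i) :
    ∃ μ ∈ ultIndex A, ∃ j ∈ ultN A μ, SameComp (edge A) i j := by
  by_contra hcon
  have hK : i ∈ ultK A n := by
    by_contra hi
    obtain ⟨ν, -, j, hj, hs⟩ := exists_hit_of_notMem_ultK hi
    exact hcon ⟨ν, mcgm_ne_zero_of_mem_critNodes hj, j, hj, hs⟩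
  obtain ⟨p, hp, hr⟩ := onCycle_iff.1 h
  have : OnCycle (edge (ultA A n)) i := by
    refine onCycle_iff.2 ⟨p, hp, ?_⟩
    rw [← pow_ne_zero_iff_reach] at hr ⊢
    rwa [ultA, pow_restrict_self (fun _ _ => mem_ultK_of_sameComp) hK]
  exact lt_irrefl n (lt_of_mem_ultIndex (A := A) (μ := n) this.mcgm_ne_zero)

end UltimateExpansion

/-! ### Growth rates of the columns at nodes on cycles. -/

section Rates

variable {n : ℕ} {A : Matrix (Fin n) (Fin n) ℝ≥0} {g : ℕ}

/-- Eventual linear periodicity with period `g` and growth rate `r`. -/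
def EvPer (g : ℕ) (f : ℕ → Fin n → ℝ≥0) (r : ℝ≥0) : Prop :=
  ∃ T, ∀ t ≥ T, ∀ i, f (t + g) i = r ^ g * f t i

/-- The sequence of the columns of `A ^ t` with index `i`. -/
def col (A : Matrix (Fin n) (Fin n) ℝ≥0) (i : Fin n) : ℕ → Fin n → ℝ≥0 :=
  fun t x => pow A t x i

lemma periodic_iterate {f : ℕ → Fin n → ℝ≥0} {r : ℝ≥0} {T : ℕ}
    (h : ∀ t ≥ T, ∀ i, f (t + g) i = r ^ g * f t i) {t : ℕ} (ht : T ≤ t) (m : ℕ) (i : Fin n) :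
    f (t + m * g) i = r ^ (m * g) * f t i := by
  induction m with
  | zero => simp
  | succ m ih =>
    rw [Nat.succ_mul, ← add_assoc, h _ (by omega), ih, pow_add]
    ring

/-- If `s < r`, dividing by `r ^ (m * q)` would force `c` to be at most a sequence tending to `0`.
-/
lemma le_of_mul_pow_le {r s c C : ℝ≥0} {q : ℕ} (hc : c ≠ 0) (hq : 0 < q)
    (h : ∀ m : ℕ, c * r ^ (m * q) ≤ C * s ^ (m * q)) : r ≤ s := by
  by_contra! hlt
  have hz : 0 < r ^ q := pow_pos ((zero_le).trans_lt hlt) q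
  have hlt' : s ^ q / r ^ q < 1 := by
    rw [div_lt_one hz]
    exact pow_lt_pow_left₀ hlt (zero_le) hq.ne'
  have ht := (NNReal.tendsto_pow_atTop_nhds_zero_of_lt_one hlt').const_mul C
  rw [mul_zero] at ht
  refine hc (le_zero_iff.1 (ge_of_tendsto' ht fun m => ?_))
  rw [div_pow, ← mul_div_assoc, le_div_iff₀ (pow_pos hz m), ← pow_mul, ← pow_mul, mul_comm q]
  exact h m

lemma rate_mono (hg : 0 < g) {i j : Fin n} {r s : ℝ≥0} (hi : EvPer g (col A i) r)
    (hj : EvPer g (col A j) s) (hc : OnCycle (edge A) j)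
    (hji : Relation.ReflTransGen (edge A) j i) : s ≤ r := by
  obtain ⟨T, hT⟩ := hi
  obtain ⟨T', hT'⟩ := hj
  obtain ⟨p, hp, hr⟩ := onCycle_iff.1 hc
  obtain ⟨d, hd⟩ := reflTransGen_iff_reach.1 hji
  -- The time `(T + T') * p` is past both thresholds and a multiple of the cycle length, so the
  -- diagonal entry at `j` is nonzero.
  have h0 : T + T' ≤ (T + T') * p := Nat.le_mul_of_pos_right _ hp
  refine le_of_mul_pow_le (c := pow A ((T + T') * p) j j * pow A d j i)
    (C := pow A ((T + T') * p + d) j i) (q := p * g)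
    (mul_ne_zero (pow_ne_zero_iff_reach.2 (hr.repeat _)) (pow_ne_zero_iff_reach.2 hd))
    (Nat.mul_pos hp hg) fun m => ?_
  have h1 := periodic_iterate hT (t := (T + T') * p + d) (by omega) (m * p) j
  have h2 := periodic_iterate hT' (t := (T + T') * p) (by omega) (m * p) j
  have h3 := pow_mul_le A ((T + T') * p + m * p * g) d j j i
  simp only [col] at h1 h2
  rw [h2, add_right_comm, h1] at h3
  rw [← mul_assoc m]
  calc _ = s ^ (m * p * g) * pow A ((T + T') * p) j j * pow A d j i := by ring
    _ ≤ _ := h3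
    _ = _ := mul_comm _ _

lemma rate_eq_ultLam (hg : 0 < g) {μ : ℕ} {k : Fin n} (hk : k ∈ ultN A μ) {r : ℝ≥0}
    (hr : EvPer g (col A k) r) : r = ultLam A μ := by
  have hlam : mcgm (ultA A μ) ≠ 0 := mcgm_ne_zero_of_mem_critNodes hk
  obtain ⟨T, hT⟩ := hr
  obtain ⟨p, hp, hle⟩ := exists_mcgm_pow_le hk
  obtain ⟨C, hC⟩ := exists_pow_le hlam
  have hpow (t : ℕ) : pow (ultA A μ) t k k = pow A t k k :=
    pow_restrict_self (fun _ _ => mem_ultK_of_sameComp) (critNodes_restrict_subset hk) t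
  have hlow (m : ℕ) : ultLam A μ ^ (m * p) ≤ pow A (m * p) k k := by
    rw [← hpow, mul_comm m, pow_mul, mul_comm p]
    exact (pow_le_pow_left₀ (zero_le) hle m).trans (pow_self_le _ _ _ _)
  have hper (m : ℕ) := periodic_iterate hT (t := T * p) (Nat.le_mul_of_pos_right _ hp) (m * p) k
  simp only [col] at hper
  apply le_antisymm
  · refine le_of_mul_pow_le (c := pow A (T * p) k k) (C := C * ultLam A μ ^ (T * p)) (q := p * g)
      ?_ (Nat.mul_pos hp hg) fun m => ?_
    · exact ((pow_pos (pos_iff_ne_zero.2 hlam) _).trans_le (hlow T)).ne'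
    · rw [← mul_assoc m, mul_comm, ← hper, ← hpow, mul_assoc C, ← pow_add]
      exact hC _ _ _
  · refine le_of_mul_pow_le (c := ultLam A μ ^ (T * p)) (C := pow A (T * p) k k) (q := p * g)
      (pow_ne_zero _ hlam) (Nat.mul_pos hp hg) fun m => ?_
    rw [← mul_assoc m, mul_comm (pow A _ k k), ← hper, ← pow_add]
    convert hlow (T + m * g) using 2 <;> ring

lemma OnCycle.of_sameComp {E : Fin n → Fin n → Prop} {i j : Fin n} (h : SameComp E i j)
    (hj : OnCycle E j) : OnCycle E i := by
  obtain ⟨p, hp, hr⟩ := onCycle_iff.1 hj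
  obtain ⟨a, ha⟩ := reflTransGen_iff_reach.1 h.1
  obtain ⟨b, hb⟩ := reflTransGen_iff_reach.1 h.2
  exact onCycle_iff.2 ⟨a + p + b, by omega, (ha.trans hr).trans hb⟩

lemma onCycle_of_mem_ultN {μ : ℕ} {k : Fin n} (hk : k ∈ ultN A μ) : OnCycle (edge A) k := by
  obtain ⟨p, hp, hr⟩ := onCycle_iff.1 (onCycle_edge hk)
  exact onCycle_iff.2 ⟨p, hp, hr.mono fun _ _ h => (edge_restrict.1 h).2⟩

/-- Removal of `x` at a step `ν < μ` would give access to `k` from a component of the larger rate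
λ_ν, against `rate_mono`. -/
lemma mem_ultK_of_reach (hg : 0 < g) {r : Fin n → ℝ≥0}
    (hr : ∀ i, OnCycle (edge A) i → EvPer g (col A i) (r i)) {μ : ℕ} {k x : Fin n}
    (hk : k ∈ ultN A μ) (hx : Relation.ReflTransGen (edge A) x k) : x ∈ ultK A μ := by
  by_contra h
  obtain ⟨ν, hν, j, hj, hs⟩ := exists_hit_of_notMem_ultK h
  have hj : j ∈ ultN A ν := hj
  have h1 := rate_mono hg (hr k (onCycle_of_mem_ultN hk)) (hr j (onCycle_of_mem_ultN hj))
    (onCycle_of_mem_ultN hj) (hs.2.trans hx)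
  rw [rate_eq_ultLam hg hk (hr k (onCycle_of_mem_ultN hk)),
    rate_eq_ultLam hg hj (hr j (onCycle_of_mem_ultN hj))] at h1
  exact (ultLam_lt hν (mcgm_ne_zero_of_mem_critNodes hk)).not_ge h1

lemma Reach.restrict {K : Set (Fin n)} {t : ℕ} {x k : Fin n} (h : Reach (edge A) t x k)
    (hK : ∀ y, Relation.ReflTransGen (edge A) y k → y ∈ K) :
    Reach (edge (restrict A K)) t x k := by
  induction t generalizing k with
  | zero => exact h
  | succ t ih =>
    obtain ⟨l, hl, e⟩ := h
    exact ⟨l, ih hl fun y hy => hK y (hy.tail e),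
      edge_restrict.2 ⟨⟨hK l (.single e), hK k .refl⟩, e⟩⟩

/-- If all nodes on cycles generate periodic orbits, the supports of the critical columns of the
ultimate terms can be read off from the walks in the whole digraph. -/
lemma mem_supp_ultTerm_iff (hg : 0 < g) {r : Fin n → ℝ≥0}
    (hr : ∀ i, OnCycle (edge A) i → EvPer g (col A i) (r i)) {μ : ℕ} {k x : Fin n}
    (hk : k ∈ ultN A μ) :
    x ∈ supp (mulVec (ultTerm A μ 1) (unitVec k)) ↔
      ∃ m, Reach (edge A) (1 + m * cyclicity (critEdge (ultA A μ))) x k := by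
  simp only [supp, Set.mem_ofPred_eq, mulVec_unitVec, ultTerm]
  rw [csr_one_ne_zero_iff hk]
  refine exists_congr fun m => ⟨fun h => h.mono fun _ _ h => (edge_restrict.1 h).2, fun h => ?_⟩
  exact h.restrict fun y hy => mem_ultK_of_reach hg hr hk hy

end Rates

/-! ### Sequences stable under maxima. -/

section Tame

variable {n : ℕ} {A : Matrix (Fin n) (Fin n) ℝ≥0} {g : ℕ} {r : Fin n → ℝ≥0}

/-- A sequence of vectors is tame with growth rate `ρ` if it is ultimately linear periodic, if all
nodes of its ultimate supports have access to a node on a cycle with rate at most `ρ`, and if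
these supports contain all nodes with access to a node on a cycle with smaller rate. -/
structure Tame (A : Matrix (Fin n) (Fin n) ℝ≥0) (g : ℕ) (r : Fin n → ℝ≥0) (ρ : ℝ≥0)
    (f : ℕ → Fin n → ℝ≥0) : Prop where
  evPer : EvPer g f ρ
  access : ∃ T, ∀ t ≥ T, ∀ x, f t x ≠ 0 →
    ∃ k, OnCycle (edge A) k ∧ r k ≤ ρ ∧ Relation.ReflTransGen (edge A) x k
  full : ∀ k, OnCycle (edge A) k → r k < ρ → ∀ x, Relation.ReflTransGen (edge A) x k →
    ∃ T, ∀ t ≥ T, f t x ≠ 0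

lemma Tame.congr {ρ : ℝ≥0} {f f' : ℕ → Fin n → ℝ≥0} (h : ∃ T, ∀ t ≥ T, ∀ x, f t x = f' t x)
    (hf : Tame A g r ρ f') : Tame A g r ρ f := by
  obtain ⟨T, hT⟩ := h
  obtain ⟨⟨T1, h1⟩, ⟨T2, h2⟩, h3⟩ := hf
  refine ⟨⟨T + T1, fun t ht x => ?_⟩, ⟨T + T2, fun t ht x hx => ?_⟩, fun k hk hr x hx => ?_⟩
  · rw [hT t (by omega), hT (t + g) (by omega), h1 t (by omega)]
  · exact h2 t (by omega) x (hT t (by omega) x ▸ hx)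
  · obtain ⟨T3, h3⟩ := h3 k hk hr x hx
    exact ⟨T + T3, fun t ht => by rw [hT t (by omega)]; exact h3 t (by omega)⟩

lemma tame_zero : Tame A g r 0 fun _ _ => 0 :=
  ⟨⟨0, by simp⟩, ⟨0, by simp⟩, fun _ _ h => absurd h not_lt_zero⟩

lemma Tame.smul {ρ : ℝ≥0} {f : ℕ → Fin n → ℝ≥0} (hf : Tame A g r ρ f) {c : ℝ≥0} (hc : c ≠ 0) :
    Tame A g r ρ fun t x => c * f t x := by
  obtain ⟨⟨T1, h1⟩, ⟨T2, h2⟩, h3⟩ := hf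
  refine ⟨⟨T1, fun t ht x => ?_⟩, ⟨T2, fun t ht x hx => ?_⟩, fun k hk hr x hx => ?_⟩
  · simp only [h1 t ht]; ring
  · exact h2 t ht x (right_ne_zero_of_mul hx)
  · obtain ⟨T3, h3⟩ := h3 k hk hr x hx
    exact ⟨T3, fun t ht => mul_ne_zero hc (h3 t ht)⟩

lemma Tame.sup {ρ : ℝ≥0} {f f' : ℕ → Fin n → ℝ≥0} (hf : Tame A g r ρ f)
    (hf' : Tame A g r ρ f') : Tame A g r ρ fun t x => f t x ⊔ f' t x := by
  obtain ⟨⟨T1, h1⟩, ⟨T2, h2⟩, h3⟩ := hf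
  obtain ⟨⟨T1', h1'⟩, ⟨T2', h2'⟩, -⟩ := hf'
  refine ⟨⟨T1 + T1', fun t ht x => ?_⟩, ⟨T2 + T2', fun t ht x hx => ?_⟩, fun k hk hr x hx => ?_⟩
  · simp only [h1 t (by omega), h1' t (by omega)]
    rw [mul_max]
  · by_cases h0 : f t x = 0
    · exact h2' t (by omega) x (by simpa [h0] using hx)
    · exact h2 t (by omega) x h0
  · obtain ⟨T3, h3⟩ := h3 k hk hr x hx
    exact ⟨T3, fun t ht => ((pos_iff_ne_zero.2 (h3 t ht)).trans_le le_sup_left).ne'⟩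

lemma eventually_mul_pow_le {ρ σ a b : ℝ≥0} (h : ρ < σ) (hg : 0 < g) (hb : b ≠ 0) :
    ∃ M, ∀ m ≥ M, ρ ^ (m * g) * a ≤ σ ^ (m * g) * b := by
  have hz : 0 < σ ^ g := pow_pos ((zero_le).trans_lt h) g
  have hlt : ρ ^ g / σ ^ g < 1 := by
    rw [div_lt_one hz]
    exact pow_lt_pow_left₀ h (zero_le) hg.ne'
  have ht := (NNReal.tendsto_pow_atTop_nhds_zero_of_lt_one hlt).mul_const a
  rw [zero_mul] at ht
  obtain ⟨M, hM⟩ := Filter.eventually_atTop.1 (ht.eventually_lt_const (pos_iff_ne_zero.2 hb))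
  refine ⟨M, fun m hm => ?_⟩
  have := (hM m hm).le
  rw [div_pow, div_mul_eq_mul_div, div_le_iff₀ (pow_pos hz m)] at this
  rwa [mul_comm m, pow_mul, pow_mul, mul_comm _ b]

/-- At a node with access to a rate at most `ρ < σ`, `full` makes `f'` eventually nonzero, so its
faster growth wins; at any other node `access` makes `f` eventually vanish. -/
lemma Tame.eventually_le {ρ σ : ℝ≥0} {f f' : ℕ → Fin n → ℝ≥0} (hg : 0 < g)
    (hf : Tame A g r ρ f) (hf' : Tame A g r σ f') (h : ρ < σ) :
    ∃ T, ∀ t ≥ T, ∀ x, f t x ≤ f' t x := by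
  suffices key : ∀ x, ∃ T, ∀ t ≥ T, f t x ≤ f' t x by
    choose T hT using key
    exact ⟨Finset.univ.sup T, fun t ht x =>
      hT x t ((Finset.le_sup (Finset.mem_univ x)).trans ht)⟩
  intro x
  obtain ⟨⟨T1, h1⟩, ⟨T2, h2⟩, -⟩ := hf
  obtain ⟨⟨T1', h1'⟩, -, h3⟩ := hf'
  by_cases hx : ∃ k, OnCycle (edge A) k ∧ r k ≤ ρ ∧ Relation.ReflTransGen (edge A) x k
  · obtain ⟨k, hk, hr, hxk⟩ := hx
    obtain ⟨T3, h3⟩ := h3 k hk (hr.trans_lt h) x hxk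
    set T := T1 + T1' + T3 with hT
    have := fun i => eventually_mul_pow_le (a := f (T + i) x) h hg (h3 (T + i) (by omega))
    choose M hM using this
    -- `M i` is the number of periods after which `f'` dominates in the residue class of `T + i`.
    refine ⟨T + (Finset.range g).sup M * g, fun t ht => ?_⟩
    have e : t = T + (t - T) % g + (t - T) / g * g := by
      have := Nat.mod_add_div' (t - T) g
      omega
    have hq : (Finset.range g).sup M ≤ (t - T) / g :=
      (Nat.le_div_iff_mul_le hg).2 (by omega)
    have hi : M ((t - T) % g) ≤ (Finset.range g).sup M :=
      Finset.le_sup (Finset.mem_range.2 (Nat.mod_lt _ hg))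
    rw [e, periodic_iterate h1 (by omega), periodic_iterate h1' (by omega)]
    exact hM _ _ (hi.trans hq)
  · refine ⟨T2, fun t ht => ?_⟩
    by_cases h0 : f t x = 0
    · rw [h0]; exact zero_le
    · exact absurd (h2 t ht x h0) hx

lemma exists_tame_sup (hg : 0 < g) {f f' : ℕ → Fin n → ℝ≥0} (hf : ∃ ρ, Tame A g r ρ f)
    (hf' : ∃ ρ, Tame A g r ρ f') : ∃ ρ, Tame A g r ρ fun t x => f t x ⊔ f' t x := by
  obtain ⟨ρ, hf⟩ := hf
  obtain ⟨σ, hf'⟩ := hf'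
  rcases lt_trichotomy ρ σ with h | rfl | h
  · obtain ⟨T, hT⟩ := hf.eventually_le hg hf' h
    exact ⟨σ, hf'.congr ⟨T, fun t ht x => sup_eq_right.2 (hT t ht x)⟩⟩
  · exact ⟨ρ, hf.sup hf'⟩
  · obtain ⟨T, hT⟩ := hf'.eventually_le hg hf h
    exact ⟨ρ, hf.congr ⟨T, fun t ht x => sup_eq_left.2 (hT t ht x)⟩⟩

lemma exists_tame_finset_sup (hg : 0 < g) {ι : Type*} (s : Finset ι)
    (F : ι → ℕ → Fin n → ℝ≥0) (c : ι → ℝ≥0)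
    (h : ∀ i ∈ s, c i ≠ 0 → ∃ ρ, Tame A g r ρ (F i)) :
    ∃ ρ, Tame A g r ρ fun t x => s.sup fun i => c i * F i t x := by
  classical
  induction s using Finset.induction_on with
  | empty => exact ⟨0, tame_zero⟩
  | insert i s _ ih =>
    simp only [Finset.sup_insert]
    refine exists_tame_sup hg ?_ (ih fun j hj => h j (Finset.mem_insert_of_mem hj))
    by_cases hc : c i = 0
    · simpa [hc] using ⟨0, tame_zero⟩
    · obtain ⟨ρ, hρ⟩ := h i (Finset.mem_insert_self i s) hc
      exact ⟨ρ, hρ.smul hc⟩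

lemma Tame.of_succ {ρ : ℝ≥0} {f : ℕ → Fin n → ℝ≥0} (hf : Tame A g r ρ fun t => f (t + 1)) :
    Tame A g r ρ f := by
  obtain ⟨⟨T1, h1⟩, ⟨T2, h2⟩, h3⟩ := hf
  refine ⟨⟨T1 + 1, fun t ht x => ?_⟩, ⟨T2 + 1, fun t ht x hx => ?_⟩, fun k hk hr x hx => ?_⟩
  · obtain ⟨t, rfl⟩ := Nat.exists_eq_add_of_le' (show 1 ≤ t by omega)
    rw [add_right_comm]
    exact h1 t (by omega) x
  · obtain ⟨t, rfl⟩ := Nat.exists_eq_add_of_le' (show 1 ≤ t by omega)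
    exact h2 t (by omega) x hx
  · obtain ⟨T3, h3⟩ := h3 k hk hr x hx
    refine ⟨T3 + 1, fun t ht => ?_⟩
    obtain ⟨t, rfl⟩ := Nat.exists_eq_add_of_le' (show 1 ≤ t by omega)
    exact h3 t (by omega)

/-- Induction over the nodes along the edges into nodes which are on no cycle. -/
lemma node_induction {E : Fin n → Fin n → Prop} {P : Fin n → Prop}
    (h1 : ∀ i, OnCycle E i → P i)
    (h2 : ∀ i, (∀ k, E k i → P k) → P i) (i : Fin n) : P i := by
  let R : Fin n → Fin n → Prop := fun k i => E k i ∧ ¬ OnCycle E i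
  have hto : ∀ {a b}, Relation.TransGen R a b → ¬ OnCycle E b := by
    intro a b h
    cases h with
    | single e => exact e.2
    | tail _ e => exact e.2
  have hreach : ∀ {a b}, Relation.TransGen R a b → ∃ p, 1 ≤ p ∧ Reach E p a b := by
    intro a b h
    induction h with
    | single e => exact ⟨1, le_rfl, reach_one e.1⟩
    | tail _ e ih =>
      obtain ⟨p, hp, hr⟩ := ih
      exact ⟨p + 1, by omega, _, hr, e.1⟩
  -- A closed chain would put its endpoint on a cycle, which the last step of the chain excludes.
  have : Std.Irrefl (Relation.TransGen R) := ⟨fun a h => hto h (onCycle_iff.2 (hreach h))⟩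
  have wf : WellFounded (Relation.TransGen R) := Finite.wellFounded_of_trans_of_irrefl _
  induction i using wf.induction with
  | _ i ih =>
    by_cases hi : OnCycle E i
    · exact h1 i hi
    · exact h2 i fun k hk => ih k (.single ⟨hk, hi⟩)

lemma exists_tame_orbit (hg : 0 < g)
    (hr : ∀ i, OnCycle (edge A) i → EvPer g (col A i) (r i))
    (hacc : ∀ k l, OnCycle (edge A) k → OnCycle (edge A) l → r k < r l →
      ∀ x, Relation.ReflTransGen (edge A) x k → ∃ T, ∀ t ≥ T, Reach (edge A) t x l)
    (y : Fin n → ℝ≥0) : ∃ ρ, Tame A g r ρ fun t => mulVec (pow A t) y := by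
  have hcol : ∀ i, ∃ ρ, Tame A g r ρ (col A i) := by
    intro i
    induction i using node_induction (E := edge A) with
    | h1 l hl =>
      refine ⟨r l, hr l hl, ⟨0, fun t _ x hx => ?_⟩, fun k hk hlt x hx => ?_⟩
      · exact ⟨l, hl, le_rfl, (pow_ne_zero_iff_reach.1 hx).rtg⟩
      · obtain ⟨T, hT⟩ := hacc k l hk hl hlt x hx
        exact ⟨T, fun t ht => pow_ne_zero_iff_reach.2 (hT t ht)⟩
    | h2 i ih =>
      -- One step later, column `i` is the max-combination of the columns of its predecessors.
      obtain ⟨ρ, h⟩ := exists_tame_finset_sup hg Finset.univ (col A) (fun k => A k i)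
        fun k _ hk => ih k hk
      have heq : (fun t => col A i (t + 1)) =
          fun t x => Finset.univ.sup fun k => A k i * col A k t x := by
        funext t x
        change (Finset.univ.sup fun k => pow A t x k * A k i) = _
        exact Finset.sup_congr rfl fun k _ => mul_comm (pow A t x k) (A k i)
      exact ⟨ρ, Tame.of_succ (heq ▸ h)⟩
  obtain ⟨ρ, h⟩ := exists_tame_finset_sup hg Finset.univ (col A) y fun k _ _ => hcol k
  have heq : (fun t => mulVec (pow A t) y) =
      fun t x => Finset.univ.sup fun k => y k * col A k t x := by
    funext t x
    exact Finset.sup_congr rfl fun k _ => mul_comm (pow A t x k) (y k)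
  exact ⟨ρ, heq ▸ h⟩

end Tame

/-! ### The two implications. -/

section Main

variable {n : ℕ} {A : Matrix (Fin n) (Fin n) ℝ≥0} {g : ℕ} {r : Fin n → ℝ≥0}

lemma rate_eq_ultLam_of_sameComp (hg : 0 < g)
    (hr : ∀ i, OnCycle (edge A) i → EvPer g (col A i) (r i)) {μ : ℕ} {i k : Fin n}
    (hk : k ∈ ultN A μ) (h : SameComp (edge A) i k) : r i = ultLam A μ := by
  have hck := onCycle_of_mem_ultN hk
  have hci := hck.of_sameComp h
  rw [← rate_eq_ultLam hg hk (hr k hck)]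
  exact le_antisymm (rate_mono hg (hr k hck) (hr i hci) hci h.1)
    (rate_mono hg (hr i hci) (hr k hck) hck h.2)

/-- The support condition implies that all nodes with access to a component of smaller growth
rate have access to the components of larger rate by walks of all large lengths. -/
lemma exists_reach_of_rate_lt (hg : 0 < g)
    (hr : ∀ i, OnCycle (edge A) i → EvPer g (col A i) (r i))
    (hsupp : ∀ μ ∈ ultIndex A, ∀ ν ∈ ultIndex A, ultLam A μ < ultLam A ν →
      (⋃ i ∈ ultN A μ, supp (mulVec (ultTerm A μ 1) (unitVec i))) ⊆
        ⋂ j ∈ ultN A ν, supp (mulVec (ultTerm A ν 1) (unitVec j)))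
    {k l : Fin n} (hk : OnCycle (edge A) k) (hl : OnCycle (edge A) l) (hlt : r k < r l)
    {x : Fin n} (hx : Relation.ReflTransGen (edge A) x k) :
    ∃ T, ∀ t ≥ T, Reach (edge A) t x l := by
  obtain ⟨μ, hμ, k', hk', hkk'⟩ := hk.exists_hit
  obtain ⟨ν, hν, l', hl', hll'⟩ := hl.exists_hit
  rw [rate_eq_ultLam_of_sameComp hg hr hk' hkk', rate_eq_ultLam_of_sameComp hg hr hl' hll'] at hlt
  have hsub := hsupp μ hμ ν hν hlt
  have hle (κ : ℕ) : ∀ i j, edge (ultA A κ) i j → edge A i j :=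
    fun _ _ h => (edge_restrict.1 h).2
  obtain ⟨t, ht⟩ := reflTransGen_iff_reach.1 (hx.trans hkk'.1)
  have hall : ∀ j ∈ ultN A ν,
      ∃ m, Reach (edge A) (1 + m * cyclicity (critEdge (ultA A ν))) x j := by
    obtain ⟨q, hq⟩ := Nat.exists_eq_add_of_le' (cyclicity_pos (E := critEdge (ultA A μ)))
    -- With `γ_μ = q + 1`, continuing the walk of length `t` by `t * q + 1` steps gives total length
    -- `1 + t * γ_μ`.
    obtain ⟨k₁, hk₁, hs⟩ := exists_critNode_reach_from hk' (t * q + 1)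
    have hmem : x ∈ supp (mulVec (ultTerm A μ 1) (unitVec k₁)) := by
      rw [mem_supp_ultTerm_iff hg hr hk₁]
      refine ⟨t, ?_⟩
      have := ht.trans (hs.mono (hle μ))
      rw [hq]
      convert this using 1
      ring
    intro j hj
    rw [← mem_supp_ultTerm_iff hg hr hj]
    exact Set.mem_iInter₂.1 (hsub (Set.mem_iUnion₂.2 ⟨k₁, hk₁, hmem⟩)) j hj
  obtain ⟨L, hL⟩ := (onCycle_critEdge hl').exists_reach_mul_cyclicity
  set γ := cyclicity (critEdge (ultA A ν)) with hγ
  have hγ0 : 0 < γ := cyclicity_pos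
  obtain ⟨d, hd⟩ := reflTransGen_iff_reach.1 hll'.2
  -- Going back `s` critical edges from `l'` before using `hall` produces every residue class modulo
  -- `γ`; closed critical walks at `l'` then fill in all large lengths.
  have hres : ∀ s, ∃ m, Reach (edge A) (1 + m * γ + s) x l' := by
    intro s
    obtain ⟨j, hj, hjs⟩ := exists_critNode_reach_to hl' s
    obtain ⟨m, hm⟩ := hall j hj
    exact ⟨m, hm.trans (hjs.mono (hle ν))⟩
  choose M hM using hres
  refine ⟨1 + d + ((Finset.range γ).sup M + L) * γ, fun t ht => ?_⟩
  have hi : M ((t - 1 - d) % γ) ≤ (Finset.range γ).sup M :=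
    Finset.le_sup (Finset.mem_range.2 (Nat.mod_lt _ hγ0))
  have hq : (Finset.range γ).sup M + L ≤ (t - 1 - d) / γ :=
    (Nat.le_div_iff_mul_le hγ0).2 (by omega)
  obtain ⟨e, he⟩ := Nat.exists_eq_add_of_le (hi.trans ((Nat.le_add_right _ L).trans hq))
  have hcl := (hL e (by omega)).mono fun _ _ h => hle ν _ _ (critEdge.edge h)
  have := ((hM ((t - 1 - d) % γ)).trans hcl).trans hd
  convert this using 1
  have h1 := Nat.mod_add_div' (t - 1 - d) γ
  rw [he, add_mul] at h1
  omega

lemma subset_supp_of_orbitPeriodic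
    (hr : ∀ i, OnCycle (edge A) i → EvPer (ultCyclicity A) (col A i) (r i))
    (h : OrbitPeriodic A) {μ ν : ℕ} (hμ : μ ∈ ultIndex A) (hν : ν ∈ ultIndex A)
    (hlt : ultLam A μ < ultLam A ν) {i j x : Fin n} (hi : i ∈ ultN A μ) (hj : j ∈ ultN A ν)
    (hx : x ∈ supp (mulVec (ultTerm A μ 1) (unitVec i))) :
    x ∈ supp (mulVec (ultTerm A ν 1) (unitVec j)) := by
  have hg : 0 < ultCyclicity A := ultCyclicity_pos
  have hci := onCycle_of_mem_ultN hi
  have hcj := onCycle_of_mem_ultN hj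
  by_contra hcon
  rw [mem_supp_ultTerm_iff hg hr hi] at hx
  rw [mem_supp_ultTerm_iff hg hr hj] at hcon
  obtain ⟨a, ha⟩ := cyclicity_dvd_ultCyclicity hμ
  obtain ⟨b, hb⟩ := cyclicity_dvd_ultCyclicity hν
  set g := ultCyclicity A
  obtain ⟨s, hs⟩ := h fun k => unitVec i k ⊔ unitVec j k
  obtain ⟨T, hT⟩ := hs
  have hmul (t : ℕ) (z : Fin n) :
      mulVec (pow A t) (fun k => unitVec i k ⊔ unitVec j k) z = pow A t z i ⊔ pow A t z j := by
    rw [← mulVec_unitVec (pow A t) i z, ← mulVec_unitVec (pow A t) j z]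
    simp only [mulVec, mul_max]
    exact Finset.sup_sup
  obtain ⟨T₁, h₁⟩ := hr i hci
  obtain ⟨T₂, h₂⟩ := hr j hcj
  rw [rate_eq_ultLam hg hi (hr i hci)] at h₁
  rw [rate_eq_ultLam hg hj (hr j hcj)] at h₂
  let F : ℕ → Fin n → ℝ≥0 := fun t z => pow A t z i ⊔ pow A t z j
  have hsum : ∀ t ≥ T, ∀ z, F (t + g) z = s ^ g * F t z := by
    intro t ht z
    simpa only [hmul] using hT t ht z
  have hlow : ultLam A ν ≤ s := by
    obtain ⟨p, hp, hrp⟩ := onCycle_iff.1 hcj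
    have h0 : T + T₂ ≤ (T + T₂) * p := Nat.le_mul_of_pos_right _ hp
    refine le_of_mul_pow_le (c := pow A ((T + T₂) * p) j j)
      (C := pow A ((T + T₂) * p) j i ⊔ pow A ((T + T₂) * p) j j) (q := g)
      (pow_ne_zero_iff_reach.2 (hrp.repeat _)) hg fun m => ?_
    have e1 := periodic_iterate (f := F) hsum (t := (T + T₂) * p) (by omega) m j
    have e2 := periodic_iterate h₂ (t := (T + T₂) * p) (by omega) m j
    simp only [col, F] at e1 e2
    rw [mul_comm, ← e2, mul_comm (_ ⊔ _), ← e1]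
    exact le_sup_right
  have hup : s ≤ ultLam A μ := by
    obtain ⟨m, hm⟩ := hx
    obtain ⟨L, hL⟩ := (onCycle_critEdge hi).exists_reach_mul_cyclicity
    set γ := cyclicity (critEdge (ultA A μ)) with hγ
    -- Closed critical walks at `i` prolong the given walk to a large length `1 + t * g`. As `g` is
    -- a multiple of `γ_ν` too, column `j` vanishes at `x` at this time and after any number of
    -- further periods.
    obtain ⟨t, ht, hreach⟩ : ∃ t, T + T₁ ≤ t ∧ Reach (edge A) (1 + t * g) x i := by
      refine ⟨T + T₁ + L + m, by omega, ?_⟩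
      have hag : 0 < a := by
        refine Nat.pos_of_ne_zero fun h0 => ?_
        rw [h0, mul_zero] at ha
        omega
      have hge : T + T₁ + L + m ≤ (T + T₁ + L + m) * a := Nat.le_mul_of_pos_right _ hag
      obtain ⟨e, he⟩ := Nat.exists_eq_add_of_le (show m ≤ (T + T₁ + L + m) * a by omega)
      have hcl := (hL e (by omega)).mono fun _ _ h => (edge_restrict.1 (critEdge.edge h)).2
      convert hm.trans hcl using 1
      rw [ha, mul_comm γ, ← mul_assoc, he]
      ring
    have htg : t ≤ t * g := Nat.le_mul_of_pos_right _ hg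
    have hzero (m : ℕ) : pow A (1 + t * g + m * g) x j = 0 := by
      by_contra h0
      refine hcon ⟨(t + m) * b, ?_⟩
      convert pow_ne_zero_iff_reach.1 h0 using 1
      rw [hb]
      ring
    refine le_of_mul_pow_le (c := pow A (1 + t * g) x i) (C := pow A (1 + t * g) x i) (q := g)
      (pow_ne_zero_iff_reach.2 hreach) hg fun m => ?_
    have e1 := periodic_iterate (f := F) hsum (t := 1 + t * g) (by omega) m x
    have e2 := periodic_iterate h₁ (t := 1 + t * g) (by omega) m x
    have z0 := hzero 0
    simp only [zero_mul, add_zero] at z0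
    simp only [col] at e2
    simp only [F, hzero, z0] at e1
    rw [max_eq_left zero_le, max_eq_left zero_le] at e1
    rw [mul_comm, ← e1, mul_comm (pow A _ x i), ← e2]
  exact hlt.not_ge (hlow.trans hup)

end Main

end MaxAlg

theorem theorem7p5 (n : ℕ) (A : Matrix (Fin n) (Fin n) ℝ≥0)
    (hA : ∀ i, MaxAlg.OnCycle (MaxAlg.edge A) i →
      MaxAlg.UltLinPeriodic A (MaxAlg.unitVec i)) :
    MaxAlg.OrbitPeriodic A ↔
      ∀ μ ∈ MaxAlg.ultIndex A, ∀ ν ∈ MaxAlg.ultIndex A,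
        MaxAlg.ultLam A μ < MaxAlg.ultLam A ν →
          (⋃ i ∈ MaxAlg.ultN A μ,
              MaxAlg.supp (MaxAlg.mulVec (MaxAlg.ultTerm A μ 1) (MaxAlg.unitVec i))) ⊆
            ⋂ j ∈ MaxAlg.ultN A ν,
              MaxAlg.supp (MaxAlg.mulVec (MaxAlg.ultTerm A ν 1) (MaxAlg.unitVec j)) := by
  have hper : ∀ i, ∃ r, MaxAlg.OnCycle (MaxAlg.edge A) i →
      MaxAlg.EvPer (MaxAlg.ultCyclicity A) (MaxAlg.col A i) r := by
    intro i
    by_cases hi : MaxAlg.OnCycle (MaxAlg.edge A) i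
    · obtain ⟨r, T, h⟩ := hA i hi
      exact ⟨r, fun _ => ⟨T, fun t ht x => by
        simpa only [MaxAlg.mulVec_unitVec, MaxAlg.col] using h t ht x⟩⟩
    · exact ⟨0, fun h => absurd h hi⟩
  choose r hr using hper
  constructor
  · intro h μ hμ ν hν hlt x hx
    obtain ⟨i, hi, hx⟩ := Set.mem_iUnion₂.1 hx
    exact Set.mem_iInter₂.2 fun j hj =>
      MaxAlg.subset_supp_of_orbitPeriodic hr h hμ hν hlt hi hj hx
  · intro hsupp y
    obtain ⟨ρ, hρ⟩ := MaxAlg.exists_tame_orbit MaxAlg.ultCyclicity_pos hr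
      (fun k l hk hl hlt x hx =>
        MaxAlg.exists_reach_of_rate_lt MaxAlg.ultCyclicity_pos hr hsupp hk hl hlt hx) y
    obtain ⟨T, hT⟩ := hρ.evPer
    exact ⟨ρ, T, hT⟩
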